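/- Let $n\ge 3$. The spin cover $\tilde A_n\to A_n$ is the pullback of $\mathrm{Spin}(n)\to \mathrm{SO}(n)$ along the permutation representation $A_n\to \mathrm{SO}(n)$; it is a central extension with kernel $\{\pm 1\}$, and each $g\in A_n$ of odd order has a unique lift $\hat g\in\tilde A_n$ of the same order. Let $\mathbf C=\{C_1,\dots,C_r\}$ be a collection (with multiplicity) of conjugacy classes of $A_n$. The Nielsen class $\mathrm{Ni}(A_n,\mathbf C)$ consists of the $r$-tuples $\mathbf g=(g_1,\dots,g_r)$ whose entries lie, in some order and with multiplicity, in the classes of $\mathbf C$, with $g_1\cdots g_r=1$ and $\langle g_1,\dots,g_r\rangle=A_n$; $\mathrm{Ni}(A_n,\mathbf C)^{\mathrm{abs}}$ is its quotient by conjugation by the elements of $S_n$ that permute the classes of $\mathbf C$ (with multiplicity). The genus $\gamma$ of $\mathbf g$ is given by the Riemann--Hurwitz formula $2(n+\gamma-1)=\sum_i \mathrm{ind}(g_i)$, where $\mathrm{ind}(g)$ is the sum of $u-1$ over the lengths $u$ of the disjoint cycles of $g$. For $g$ of odd order let $\omega(g)\in\mathbb Z/2$ be the sum of $\frac{u^2-1}{8}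 \bmod 2$ over the lengths $u$ of the disjoint cycles of $g$. If the $g_i$ have odd order, the lift invariant $s_{\mathbf g}\in\mathbb Z/2$ is defined by $\hat g_1\cdots\hat g_r=(-1)^{s_{\mathbf g}}$. Assume that $\mathbf C$ is odd-cycle, that is, all elements of its classes have odd order. Then every $\mathbf g\in \mathrm{Ni}(A_n,\mathbf C)^{\mathrm{abs}}$ of genus $0$ has lift invariant (the same for all representatives of $\mathbf g$) $$s_{\mathbf g}=\sum_{i=1}^r \omega(g_i) \bmod 2,\qquad\text{equivalently}\qquad \hat g_1\cdots\hat g_r=\prod_{i=1}^r(-1)^{\omega(g_i)},$$ and, if the genus is $0$, $s_{\mathbf g}$ is constant on $\mathrm{Ni}(A_n,\mathbf C)^{\mathrm{abs}}$. For example, if $\mathbf C$ consists of $n-1$ classes of $3$-cycles, then every element of $\mathrm{Ni}(A_n,\mathbf C)^{\mathrm{abs}}$ has genus $0$ and lift invariant $n-1 \bmod 2$. -/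

import Mathlib

namespace SpinLift

/-! ### The spin cover of the alternating group -/

/-- The standard quadratic form `x ↦ ∑ xᵢ²` on `ℝⁿ`. -/
noncomputable abbrev stdForm (n : ℕ) : QuadraticForm ℝ (Fin n → ℝ) :=
  QuadraticMap.weightedSumSquares ℝ (fun _ : Fin n => (1 : ℝ))

/-- `σ ∈ Sₙ` acting on `ℝⁿ` by permuting the standard basis, `eⱼ ↦ e_{σ j}`. -/
def permVec {n : ℕ} (σ : Equiv.Perm (Fin n)) (v : Fin n → ℝ) : Fin n → ℝ :=
  fun i => v (σ⁻¹ i)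

/-- The spin cover of `Aₙ`: the fibre product of `Spin(n) → SO(n)` (where `x ∈ Spin(n)` acts on
`ℝⁿ`, inside the Clifford algebra, by `v ↦ x v x⁻¹`) and the permutation representation
`Aₙ → SO(n)`. -/
noncomputable def spinCover (n : ℕ) :
    Subgroup (spinGroup (stdForm n) × alternatingGroup (Fin n)) where
  carrier := {p | ∀ v : Fin n → ℝ,
    (p.1 : CliffordAlgebra (stdForm n)) * CliffordAlgebra.ι (stdForm n) v *
        ((p.1⁻¹ : spinGroup (stdForm n)) : CliffordAlgebra (stdForm n)) =
      CliffordAlgebra.ι (stdForm n) (permVec (p.2 : Equiv.Perm (Fin n)) v)}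
  one_mem' := by
    intro v
    simp only [Prod.fst_one, Prod.snd_one, inv_one, OneMemClass.coe_one, one_mul, mul_one]
    rfl
  mul_mem' := by
    intro p q hp hq v
    have h : permVec ((p * q).2 : Equiv.Perm (Fin n)) v
        = permVec (p.2 : Equiv.Perm (Fin n)) (permVec (q.2 : Equiv.Perm (Fin n)) v) := by
      funext i
      simp [permVec, mul_inv_rev]
    rw [h, ← hp, ← hq]
    simp only [Prod.fst_mul, mul_inv_rev, Submonoid.coe_mul, mul_assoc]
  inv_mem' := by
    intro p hp v
    have h := hp (permVec ((p.2 : Equiv.Perm (Fin n))⁻¹) v)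
    have h2 : permVec (p.2 : Equiv.Perm (Fin n)) (permVec ((p.2 : Equiv.Perm (Fin n))⁻¹) v)
        = v := by
      funext i
      simp [permVec]
    have hl : ((p.1⁻¹ : spinGroup (stdForm n)) : CliffordAlgebra (stdForm n)) * p.1 = 1 := by
      rw [← Submonoid.coe_mul, inv_mul_cancel, Submonoid.coe_one]
    rw [h2] at h
    rw [← h]
    simp only [Prod.fst_inv, Prod.snd_inv, inv_inv, InvMemClass.coe_inv]
    rw [mul_assoc, mul_assoc, mul_assoc, hl, mul_one, ← mul_assoc, hl, one_mul]

/-- The covering map from the spin cover to `Aₙ`. -/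
noncomputable def spinProj (n : ℕ) : spinCover n →* alternatingGroup (Fin n) :=
  (MonoidHom.snd _ _).comp (spinCover n).subtype

/-- The element of the Clifford algebra underlying an element of the spin cover. -/
noncomputable def spinVal {n : ℕ} (x : spinCover n) : CliffordAlgebra (stdForm n) :=
  (x.1.1 : CliffordAlgebra (stdForm n))

/-- `x` is a lift of `g` to the spin cover that has the same order as `g`. -/
def IsSameOrderLift {n : ℕ} (g : alternatingGroup (Fin n)) (x : spinCover n) : Prop :=
  spinProj n x = g ∧ orderOf x = orderOf g

/-- `s ∈ ℤ/2` is the lift invariant of `(g₁, …, g_r)`: the product of the lifts `ĝᵢ` of the `gᵢ`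
of the same order is `(-1)ˢ`. -/
def IsLiftInvariant {n : ℕ} (g : List (alternatingGroup (Fin n))) (s : ZMod 2) : Prop :=
  ∃ x : List (spinCover n), List.Forall₂ IsSameOrderLift g x ∧ spinVal x.prod = (-1) ^ s.val

/-! ### Nielsen classes of the alternating group -/

/-- The tuples `(g₁, …, g_r)` with entries in the classes `C`, in some order and with the right
multiplicities, that have product one and generate `Aₙ`. -/
def Nielsen (n : ℕ) (C : Multiset (ConjClasses (alternatingGroup (Fin n)))) : Type :=
  {g : List (alternatingGroup (Fin n)) //
    ((g.map ConjClasses.mk : List _) : Multiset (ConjClasses (alternatingGroup (Fin n)))) = C ∧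
    g.prod = 1 ∧ Subgroup.closure {a | a ∈ g} = ⊤}

/-- Conjugation by `α ∈ Sₙ` as an automorphism of `Aₙ`. -/
def conjAlt {n : ℕ} (α : Equiv.Perm (Fin n)) : MulAut (alternatingGroup (Fin n)) :=
  MulAut.conjNormal α

/-- The elements of `Sₙ` (all of them normalize `Aₙ`) that permute the classes of `C`, with
multiplicities. -/
def normalizerC (n : ℕ) (C : Multiset (ConjClasses (alternatingGroup (Fin n)))) :
    Set (Equiv.Perm (Fin n)) :=
  {α | C.map (ConjClasses.map (conjAlt α).toMonoidHom) = C}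

/-- Absolute equivalence: conjugation by an element of `N_{Sₙ}(Aₙ, C)`. -/
def absSetoid (n : ℕ) (C : Multiset (ConjClasses (alternatingGroup (Fin n)))) :
    Setoid (Nielsen n C) where
  r g h := ∃ α ∈ normalizerC n C, h.1 = g.1.map (conjAlt α)
  iseqv := by
    have hcomp : ∀ α β : Equiv.Perm (Fin n), ∀ D : Multiset _,
        D.map (ConjClasses.map (conjAlt (n := n) (α * β)).toMonoidHom) =
          (D.map (ConjClasses.map (conjAlt β).toMonoidHom)).map
            (ConjClasses.map (conjAlt α).toMonoidHom) := by
      intro α β D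
      rw [Multiset.map_map]
      refine Multiset.map_congr rfl ?_
      intro c _
      obtain ⟨a, rfl⟩ := ConjClasses.exists_rep c
      simp [ConjClasses.map, conjAlt, ConjClasses.mk]
      rfl
    have hone : ∀ D : Multiset _,
        D.map (ConjClasses.map (conjAlt (n := n) 1).toMonoidHom) = D := by
      intro D
      conv_rhs => rw [← Multiset.map_id D]
      refine Multiset.map_congr rfl ?_
      intro c _
      obtain ⟨a, rfl⟩ := ConjClasses.exists_rep c
      simp [ConjClasses.map, conjAlt, ConjClasses.mk]
      rfl
    refine ⟨fun g => ⟨1, hone C, ?_⟩, ?_, ?_⟩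
    · simp [conjAlt]
    · rintro g h ⟨α, hα, e⟩
      refine ⟨α⁻¹, ?_, ?_⟩
      · have h1 := hcomp α⁻¹ α C
        rw [inv_mul_cancel, hone, show C.map _ = C from hα] at h1
        exact h1.symm
      · rw [e, List.map_map]
        conv_lhs => rw [← List.map_id g.1]
        refine List.map_congr_left ?_
        intro a _
        simp [conjAlt]
    · rintro g h k ⟨α, hα, e⟩ ⟨β, hβ, f⟩
      refine ⟨β * α, ?_, ?_⟩
      · change C.map _ = C
        rw [hcomp, show C.map _ = C from hα]
        exact hβ
      · rw [f, e, List.map_map]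
        refine List.map_congr_left ?_
        intro a _
        simp [conjAlt]

/-- The absolute Nielsen classes `Ni(Aₙ, C)^abs = Ni(Aₙ, C) / N_{Sₙ}(Aₙ, C)`. -/
def NielsenAbs (n : ℕ) (C : Multiset (ConjClasses (alternatingGroup (Fin n)))) : Type :=
  Quotient (absSetoid n C)

/-- All elements of the classes in `C` have odd order. -/
def IsOddCycle {n : ℕ} (C : Multiset (ConjClasses (alternatingGroup (Fin n)))) : Prop :=
  ∀ g : alternatingGroup (Fin n), ConjClasses.mk g ∈ C → Odd (orderOf g)

/-- All elements of the classes in `C` are 3-cycles. -/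
def IsThreeCycles {n : ℕ} (C : Multiset (ConjClasses (alternatingGroup (Fin n)))) : Prop :=
  ∀ g : alternatingGroup (Fin n), ConjClasses.mk g ∈ C → (g : Equiv.Perm (Fin n)).IsThreeCycle

/-- The index of `g`: the sum of `u - 1` over the lengths `u` of its disjoint cycles. -/
def index {n : ℕ} (g : alternatingGroup (Fin n)) : ℕ :=
  ((g : Equiv.Perm (Fin n)).cycleType.map (fun u => u - 1)).sum

/-- `ω(g)`: the sum of `(u² - 1) / 8` modulo 2 over the lengths `u` of the disjoint cycles of `g`,
for `g` of odd order (`cycleType` omits the cycles of length 1, which contribute 0). -/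
def omega {n : ℕ} (g : alternatingGroup (Fin n)) : ZMod 2 :=
  (((g : Equiv.Perm (Fin n)).cycleType.map (fun u => (u ^ 2 - 1) / 8)).sum : ℕ)

theorem cycleType_conjAlt {n : ℕ} (α : Equiv.Perm (Fin n)) (g : alternatingGroup (Fin n)) :
    (conjAlt α g : Equiv.Perm (Fin n)).cycleType = (g : Equiv.Perm (Fin n)).cycleType := by
  rw [conjAlt, MulAut.conjNormal_apply, Equiv.Perm.cycleType_conj]

/-- The sum of the indices of the entries of an absolute Nielsen class. -/
def NielsenAbs.indexSum {n : ℕ} {C : Multiset (ConjClasses (alternatingGroup (Fin n)))}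
    (c : NielsenAbs n C) : ℕ :=
  Quotient.lift (fun g : Nielsen n C => (g.1.map index).sum) (by
    rintro g h ⟨α, -, e⟩
    simp only [e, List.map_map]
    refine congrArg List.sum (List.map_congr_left fun a _ => ?_)
    simp only [Function.comp_apply, index, cycleType_conjAlt]) c

/-- The covers of the sphere of degree `n` in the class `c` have genus `γ`, as given by the
Riemann-Hurwitz formula `2 (n + γ - 1) = ∑ ind(gᵢ)`. -/
def NielsenAbs.HasGenus {n : ℕ} {C : Multiset (ConjClasses (alternatingGroup (Fin n)))}
    (c : NielsenAbs n C) (γ : ℕ) : Prop :=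
  2 * ((n : ℤ) + γ - 1) = c.indexSum

/-- `∑ ω(gᵢ)` modulo 2, for an absolute Nielsen class. -/
def NielsenAbs.omegaSum {n : ℕ} {C : Multiset (ConjClasses (alternatingGroup (Fin n)))}
    (c : NielsenAbs n C) : ZMod 2 :=
  Quotient.lift (fun g : Nielsen n C => (g.1.map omega).sum) (by
    rintro g h ⟨α, -, e⟩
    simp only [e, List.map_map]
    refine congrArg List.sum (List.map_congr_left fun a _ => ?_)
    simp only [Function.comp_apply, omega, cycleType_conjAlt]) c

/-- The set of the lift invariants of the representatives of an absolute Nielsen class. -/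
def NielsenAbs.liftInvariants {n : ℕ} {C : Multiset (ConjClasses (alternatingGroup (Fin n)))}
    (c : NielsenAbs n C) : Set (ZMod 2) :=
  {s | ∃ g : Nielsen n C, Quotient.mk (absSetoid n C) g = c ∧ IsLiftInvariant g.1 s}

end SpinLift

namespace SpinLift

open CliffordAlgebra

variable {n : ℕ}

/-! ### Generators of the Clifford algebra of the standard form -/

/-- The Clifford algebra of the standard form on `ℝⁿ`. -/
abbrev Cl (n : ℕ) : Type := CliffordAlgebra (stdForm n)

/-- The generator of the Clifford algebra given by a standard basis vector. -/
noncomputable def gen (i : Fin n) : Cl n := ι (stdForm n) (Pi.single i 1)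

theorem stdForm_apply (v : Fin n → ℝ) : stdForm n v = ∑ i, v i * v i := by
  simp [stdForm, QuadraticMap.weightedSumSquares_apply]

theorem gen_mul_self (i : Fin n) : gen i * gen i = 1 := by
  rw [gen, ι_sq_scalar, stdForm_apply]
  simp [Pi.single_apply]

theorem gen_anticomm {i j : Fin n} (h : i ≠ j) : gen i * gen j = -(gen j * gen i) := by
  apply ι_mul_ι_comm_of_isOrtho
  rw [QuadraticMap.isOrtho_def, stdForm_apply, stdForm_apply, stdForm_apply,
    ← Finset.sum_add_distrib]
  refine Finset.sum_congr rfl fun k _ => ?_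
  simp only [Pi.add_apply, Pi.single_apply]
  split_ifs with h1 h2
  · exact absurd (h1.symm.trans h2) h
  all_goals norm_num

theorem gen_mul_gen_mul (i : Fin n) (x : Cl n) : gen i * (gen i * x) = x := by
  rw [← mul_assoc, gen_mul_self, one_mul]

theorem ι_eq_sum_gen (v : Fin n → ℝ) : ι (stdForm n) v = ∑ i, v i • gen i := by
  conv_lhs => rw [← Finset.univ_sum_single v]
  rw [map_sum]
  refine Finset.sum_congr rfl fun i _ => ?_
  rw [gen, ← map_smul, ← Pi.single_smul, smul_eq_mul, mul_one]

/-- Conjugation by a generator. -/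
noncomputable def genConj (i : Fin n) : Cl n →ₐ[ℝ] Cl n :=
  AlgHom.ofLinearMap
    (LinearMap.mulLeft ℝ (gen i) ∘ₗ LinearMap.mulRight ℝ (gen i))
    (by simp [gen_mul_self])
    (fun x y => by
      simp only [LinearMap.comp_apply, LinearMap.mulLeft_apply, LinearMap.mulRight_apply,
        mul_assoc, gen_mul_gen_mul])

theorem genConj_apply (i : Fin n) (x : Cl n) : genConj i x = gen i * x * gen i := by
  simp [genConj, mul_assoc]

theorem genConj_gen_self (i : Fin n) : genConj i (gen i) = gen i := by
  rw [genConj_apply, mul_assoc, gen_mul_gen_mul]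

theorem genConj_gen_of_ne {i j : Fin n} (h : i ≠ j) : genConj i (gen j) = -gen j := by
  rw [genConj_apply, gen_anticomm h, neg_mul, mul_assoc, gen_mul_self, mul_one]

theorem genConj_genConj_self (i : Fin n) (x : Cl n) : genConj i (genConj i x) = x := by
  simp only [genConj_apply, mul_assoc, gen_mul_self, mul_one, gen_mul_gen_mul]

theorem genConj_comm (i j : Fin n) (x : Cl n) :
    genConj i (genConj j x) = genConj j (genConj i x) := by
  rcases eq_or_ne i j with rfl | h
  · rfl
  · have h1 : gen i * (gen j * x * gen j) * gen i = (gen i * gen j) * x * (gen j * gen i) := by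
      simp only [mul_assoc]
    rw [genConj_apply, genConj_apply, h1, gen_anticomm h, genConj_apply, genConj_apply, neg_mul,
      neg_mul, ← mul_neg, ← gen_anticomm h]
    simp only [mul_assoc]

theorem genConj_eq_self_of_commute {i : Fin n} {x : Cl n} (h : Commute x (gen i)) :
    genConj i x = x := by
  rw [genConj_apply, mul_assoc, h.eq, gen_mul_gen_mul]

/-! ### The scalar part of an even element -/

/-- The projection to the elements fixed by conjugation by a generator. -/
noncomputable def genAvg (i : Fin n) : Module.End ℝ (Cl n) :=
  (2⁻¹ : ℝ) • (1 + (genConj i).toLinearMap)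

theorem genAvg_apply (i : Fin n) (x : Cl n) : genAvg i x = (2⁻¹ : ℝ) • (x + genConj i x) := rfl

/-- The average over the conjugations by all products of generators. On even elements this is the
scalar part. -/
noncomputable def scalarPart (n : ℕ) : Module.End ℝ (Cl n) :=
  ((List.finRange n).map genAvg).prod

theorem genAvg_genConj_comm (i j : Fin n) (x : Cl n) :
    genAvg i (genConj j x) = genConj j (genAvg i x) := by
  simp only [genAvg_apply, map_smul, map_add, genConj_comm i j]

theorem prod_genAvg_genConj (l : List (Fin n)) (j : Fin n) (x : Cl n) :
    (l.map genAvg).prod (genConj j x) = genConj j ((l.map genAvg).prod x) := by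
  induction l with
  | nil => simp
  | cons a l ih => simp [Module.End.mul_apply, ih, genAvg_genConj_comm]

theorem prod_genAvg_genConj_of_mem {l : List (Fin n)} {j : Fin n} (h : j ∈ l) (x : Cl n) :
    (l.map genAvg).prod (genConj j x) = (l.map genAvg).prod x := by
  induction l with
  | nil => simp at h
  | cons a l ih =>
    rw [List.map_cons, List.prod_cons, Module.End.mul_apply, Module.End.mul_apply]
    rcases List.mem_cons.1 h with rfl | h
    · rw [prod_genAvg_genConj, genAvg_apply, genAvg_apply, genConj_genConj_self, add_comm]
    · rw [ih h]

theorem scalarPart_genConj (i : Fin n) (x : Cl n) :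
    scalarPart n (genConj i x) = scalarPart n x :=
  prod_genAvg_genConj_of_mem (List.mem_finRange i) x

theorem scalarPart_eq_zero {i : Fin n} {x : Cl n} (h : genConj i x = -x) :
    scalarPart n x = 0 := by
  have h1 := scalarPart_genConj i x
  rw [h, map_neg] at h1
  have h2 : (2 : ℝ) • scalarPart n x = 0 := by
    rw [two_smul]
    nth_rewrite 1 [← h1]
    exact neg_add_cancel _
  exact (smul_eq_zero.1 h2).resolve_left two_ne_zero

theorem scalarPart_eq_self {x : Cl n} (h : ∀ i, genConj i x = x) : scalarPart n x = x := by
  rw [scalarPart]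
  induction List.finRange n with
  | nil => simp
  | cons a l ih =>
    rw [List.map_cons, List.prod_cons, Module.End.mul_apply, ih, genAvg_apply, h, ← two_smul ℝ x,
      smul_smul]
    norm_num

theorem scalarPart_one : scalarPart n 1 = 1 := scalarPart_eq_self fun _ => map_one _

theorem scalarPart_algebraMap (r : ℝ) :
    scalarPart n (algebraMap ℝ _ r) = algebraMap ℝ _ r :=
  scalarPart_eq_self fun _ => AlgHom.commutes _ _

/-! ### Words in the generators -/

/-- The product of the generators in a word. -/
noncomputable def word (w : List (Fin n)) : Cl n := (w.map gen).prod

theorem word_nil : word ([] : List (Fin n)) = 1 := rfl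

theorem word_cons (i : Fin n) (w : List (Fin n)) : word (i :: w) = gen i * word w := by
  simp [word]

theorem word_append (v w : List (Fin n)) : word (v ++ w) = word v * word w := by
  simp [word]

theorem genConj_word (i : Fin n) (w : List (Fin n)) :
    genConj i (word w) = (-1 : ℝ) ^ (w.length + w.count i) • word w := by
  induction w with
  | nil => simp [word_nil]
  | cons a w ih =>
    rw [word_cons, map_mul, ih, mul_smul_comm, List.length_cons, List.count_cons]
    rcases eq_or_ne i a with rfl | h
    · rw [genConj_gen_self, beq_self_eq_true, if_pos rfl,
        show w.length + 1 + (w.count i + 1) = w.length + w.count i + 2 by ring, pow_add _ _ 2]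
      norm_num
    · rw [genConj_gen_of_ne h, if_neg (by simpa using h.symm),
        show w.length + 1 + (w.count i + 0) = w.length + w.count i + 1 by ring, pow_succ]
      simp

theorem word_eq_one_or_neg_one (w : List (Fin n)) (h : ∀ i, Even (w.count i)) :
    word w = 1 ∨ word w = -1 := by
  induction hk : w.length using Nat.strong_induction_on generalizing w with
  | _ k ih =>
    subst hk
    cases w with
    | nil => exact Or.inl rfl
    | cons i w =>
      have hi : i ∈ w := by
        by_contra hi
        have := h i
        rw [List.count_cons_self, List.count_eq_zero_of_not_mem hi] at this
        exact absurd this (by decide)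
      obtain ⟨a, b, rfl⟩ := List.append_of_mem hi
      have h1 : word (i :: (a ++ i :: b)) =
          (-1 : ℝ) ^ (a.length + a.count i) • word (a ++ b) := by
        rw [word_cons, word_append, word_cons, word_append, ← smul_mul_assoc, ← genConj_word,
          genConj_apply]
        simp only [mul_assoc]
      have h2 := ih (a ++ b).length (by simp) (a ++ b) (fun j => by
        have := h j
        simp only [List.count_cons, List.count_append] at this ⊢
        split_ifs at this with hh
        · rw [show a.count j + (b.count j + 1) + 1 = a.count j + b.count j + 2 by ring] at this
          exact (Nat.even_add.1 this).2 even_two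
        · simpa using this) rfl
      rw [h1]
      rcases neg_one_pow_eq_or ℝ (a.length + a.count i) with h3 | h3 <;> rcases h2 with h2 | h2 <;>
        simp [h2, h3]

theorem scalarPart_word_of_odd {w : List (Fin n)} (hw : Even w.length) {i : Fin n}
    (h : Odd (w.count i)) : scalarPart n (word w) = 0 := by
  refine scalarPart_eq_zero (i := i) ?_
  rw [genConj_word, (hw.add_odd h).neg_one_pow]
  simp

/-- Even words have scalar part `0`, `1` or `-1`. -/
theorem scalarPart_word {w : List (Fin n)} (hw : Even w.length) :
    ∃ r : ℝ, scalarPart n (word w) = algebraMap ℝ _ r ∧ -1 ≤ r ∧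
      ((∃ i, Odd (w.count i)) → r = 0) ∧ (w = [] → r = 1) := by
  by_cases h : ∃ i, Odd (w.count i)
  · refine ⟨0, ?_, by norm_num, fun _ => rfl, ?_⟩
    · obtain ⟨i, hi⟩ := h
      rw [scalarPart_word_of_odd hw hi, map_zero]
    · rintro rfl
      simp at h
  · by_cases h0 : w = []
    · refine ⟨1, ?_, by norm_num, fun h' => absurd h' h, fun _ => rfl⟩
      rw [h0, word_nil, scalarPart_one, map_one]
    · simp only [not_exists, Nat.not_odd_iff_even] at h
      rcases word_eq_one_or_neg_one w h with h1 | h1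
      · exact ⟨1, by rw [h1, scalarPart_one, map_one], by norm_num,
          fun ⟨i, hi⟩ => absurd (h i) (Nat.not_even_iff_odd.2 hi), fun h => absurd h h0⟩
      · exact ⟨-1, by rw [h1, map_neg, scalarPart_one, map_neg, map_one], by norm_num,
          fun ⟨i, hi⟩ => absurd (h i) (Nat.not_even_iff_odd.2 hi), fun h => absurd h h0⟩

theorem mem_span_word_of_mem_even {x : Cl n} (hx : x ∈ even (stdForm n)) :
    x ∈ Submodule.span ℝ {y | ∃ w : List (Fin n), Even w.length ∧ word w = y} := by
  set S := Submodule.span ℝ {y | ∃ w : List (Fin n), Even w.length ∧ word w = y} with hS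
  replace hx : x ∈ evenOdd (stdForm n) 0 := hx
  induction x, hx using even_induction with
  | algebraMap r =>
    rw [Algebra.algebraMap_eq_smul_one]
    exact S.smul_mem r (Submodule.subset_span ⟨[], by simp, word_nil⟩)
  | add x y hx hy ihx ihy => exact S.add_mem ihx ihy
  | ι_mul_ι_mul a b x hx ih =>
    have h1 : ∀ i j, ∀ y ∈ S, gen i * gen j * y ∈ S := by
      intro i j y hy
      induction hy using Submodule.span_induction with
      | mem y hy =>
        obtain ⟨w, hw, rfl⟩ := hy
        refine Submodule.subset_span ⟨i :: j :: w, ?_, by simp only [word_cons, mul_assoc]⟩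
        rw [List.length_cons, List.length_cons, add_assoc]
        exact hw.add even_two
      | zero => simp
      | add y z _ _ hy hz => rw [mul_add]; exact S.add_mem hy hz
      | smul r y _ hy => rw [mul_smul_comm]; exact S.smul_mem r hy
    rw [ι_eq_sum_gen, ι_eq_sum_gen, Finset.sum_mul_sum, Finset.sum_mul]
    refine S.sum_mem fun i _ => ?_
    rw [Finset.sum_mul]
    refine S.sum_mem fun j _ => ?_
    rw [smul_mul_smul_comm, smul_mul_assoc]
    exact S.smul_mem _ (h1 i j x ih)

theorem scalarPart_mem_range {x : Cl n} (hx : x ∈ even (stdForm n)) :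
    ∃ r : ℝ, scalarPart n x = algebraMap ℝ _ r := by
  have := mem_span_word_of_mem_even hx
  clear hx
  induction this using Submodule.span_induction with
  | mem y hy =>
    obtain ⟨w, hw, rfl⟩ := hy
    obtain ⟨r, hr, -⟩ := scalarPart_word hw
    exact ⟨r, hr⟩
  | zero => exact ⟨0, by simp⟩
  | add y z _ _ hy hz =>
    obtain ⟨r, hr⟩ := hy
    obtain ⟨s, hs⟩ := hz
    exact ⟨r + s, by rw [map_add, hr, hs, map_add]⟩
  | smul c y _ hy =>
    obtain ⟨r, hr⟩ := hy
    exact ⟨c * r, by rw [map_smul, hr, map_mul, Algebra.smul_def]⟩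

/-- An even element that commutes with all vectors is a scalar. -/
theorem eq_algebraMap_of_commute {x : Cl n} (hx : x ∈ even (stdForm n))
    (h : ∀ i, Commute x (gen i)) : ∃ r : ℝ, x = algebraMap ℝ _ r := by
  obtain ⟨r, hr⟩ := scalarPart_mem_range hx
  exact ⟨r, by rw [← hr, scalarPart_eq_self fun i => genConj_eq_self_of_commute (h i)]⟩

theorem algebraMap_Cl_injective : Function.Injective (algebraMap ℝ (Cl n)) :=
  FaithfulSMul.algebraMap_injective ℝ (Cl n)

/-! ### Products over lists of edges -/

/-- For `a ≠ b`, a multiple of the rotation by a right angle that takes `e_a` to `e_b`. -/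
noncomputable def edgeFactor (p : Fin n × Fin n) : Cl n := 1 + gen p.2 * gen p.1

/-- The product of the factors of a list of edges. -/
noncomputable def edgeProd (L : List (Fin n × Fin n)) : Cl n := (L.map edgeFactor).prod

theorem edgeProd_nil : edgeProd ([] : List (Fin n × Fin n)) = 1 := rfl

theorem edgeProd_cons (p : Fin n × Fin n) (L : List (Fin n × Fin n)) :
    edgeProd (p :: L) = edgeFactor p * edgeProd L := by
  simp [edgeProd]

theorem edgeProd_append (L K : List (Fin n × Fin n)) :
    edgeProd (L ++ K) = edgeProd L * edgeProd K := by
  simp [edgeProd]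

theorem gen_mul_gen_mem_even (i j : Fin n) : gen i * gen j ∈ even (stdForm n) :=
  ι_mul_ι_mem_evenOdd_zero _ _ _

theorem edgeProd_mem_even (L : List (Fin n × Fin n)) : edgeProd L ∈ even (stdForm n) := by
  refine list_prod_mem fun x hx => ?_
  obtain ⟨p, -, rfl⟩ := List.mem_map.1 hx
  exact add_mem (one_mem _) (gen_mul_gen_mem_even _ _)

theorem star_gen (i : Fin n) : star (gen i) = -gen i := star_ι _

theorem star_edgeFactor (p : Fin n × Fin n) : star (edgeFactor p) = 1 + gen p.1 * gen p.2 := by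
  rw [edgeFactor, star_add, star_one, star_mul, star_gen, star_gen, neg_mul_neg]

theorem edgeFactor_mul_star {p : Fin n × Fin n} (h : p.1 ≠ p.2) :
    edgeFactor p * star (edgeFactor p) = algebraMap ℝ _ 2 := by
  rw [star_edgeFactor, edgeFactor, add_mul, mul_add, mul_add, one_mul, one_mul, mul_one,
    mul_assoc, gen_mul_gen_mul, gen_mul_self, gen_anticomm h, map_ofNat,
    ← one_add_one_eq_two]
  abel

theorem star_mul_edgeFactor {p : Fin n × Fin n} (h : p.1 ≠ p.2) :
    star (edgeFactor p) * edgeFactor p = algebraMap ℝ _ 2 := by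
  rw [star_edgeFactor, edgeFactor, add_mul, mul_add, mul_add, one_mul, one_mul, mul_one,
    mul_assoc, gen_mul_gen_mul, gen_mul_self, gen_anticomm h, map_ofNat,
    ← one_add_one_eq_two]
  abel

theorem edgeProd_mul_star {L : List (Fin n × Fin n)} (h : ∀ p ∈ L, p.1 ≠ p.2) :
    edgeProd L * star (edgeProd L) = algebraMap ℝ _ (2 ^ L.length) := by
  induction L with
  | nil => simp [edgeProd_nil]
  | cons p L ih =>
    rw [edgeProd_cons, star_mul, mul_assoc, ← mul_assoc (edgeProd L),
      ih fun q hq => h q (List.mem_cons_of_mem _ hq), Algebra.left_comm,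
      edgeFactor_mul_star (h p List.mem_cons_self), List.length_cons, pow_succ, map_mul]

theorem star_mul_edgeProd {L : List (Fin n × Fin n)} (h : ∀ p ∈ L, p.1 ≠ p.2) :
    star (edgeProd L) * edgeProd L = algebraMap ℝ _ (2 ^ L.length) := by
  induction L with
  | nil => simp [edgeProd_nil]
  | cons p L ih =>
    rw [edgeProd_cons, star_mul, mul_assoc, ← mul_assoc (star (edgeFactor p)),
      star_mul_edgeFactor (h p List.mem_cons_self), Algebra.left_comm,
      ih fun q hq => h q (List.mem_cons_of_mem _ hq), List.length_cons, pow_succ, mul_comm (2 ^ _),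
      map_mul]

theorem isUnit_edgeProd {L : List (Fin n × Fin n)} (h : ∀ p ∈ L, p.1 ≠ p.2) :
    IsUnit (edgeProd L) := by
  have hu : IsUnit (algebraMap ℝ (Cl n) (2 ^ L.length)) :=
    (IsUnit.mk0 (2 ^ L.length : ℝ) (by positivity)).map _
  rw [isUnit_iff_exists_and_exists]
  obtain ⟨c, hc⟩ := hu.exists_right_inv
  obtain ⟨d, hd⟩ := hu.exists_left_inv
  exact ⟨⟨star (edgeProd L) * c, by rw [← mul_assoc, edgeProd_mul_star h, hc]⟩,
    ⟨d * star (edgeProd L), by rw [mul_assoc, star_mul_edgeProd h, hd]⟩⟩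

theorem genConj_edgeFactor_of_ne {i : Fin n} {p : Fin n × Fin n} (h1 : i ≠ p.1) (h2 : i ≠ p.2) :
    genConj i (edgeFactor p) = edgeFactor p := by
  rw [edgeFactor, map_add, map_one, map_mul, genConj_gen_of_ne h1, genConj_gen_of_ne h2,
    neg_mul_neg]

theorem genConj_edgeProd_of_ne {i : Fin n} {L : List (Fin n × Fin n)}
    (h : ∀ p ∈ L, i ≠ p.1 ∧ i ≠ p.2) : genConj i (edgeProd L) = edgeProd L := by
  induction L with
  | nil => simp [edgeProd_nil]
  | cons p L ih =>
    rw [edgeProd_cons, map_mul, ih fun q hq => h q (List.mem_cons_of_mem _ hq),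
      genConj_edgeFactor_of_ne (h p List.mem_cons_self).1 (h p List.mem_cons_self).2]

theorem commute_gen_of_genConj {i : Fin n} {x : Cl n} (h : genConj i x = x) :
    Commute x (gen i) := by
  have h1 : gen i * genConj i x = x * gen i := by
    rw [genConj_apply, mul_assoc, gen_mul_gen_mul]
  rw [h] at h1
  exact h1.symm

/-! ### Elements that act on the vectors by a permutation -/

/-- Conjugation by `x` takes `e_j` to `e_{σ j}`. -/
def Intertwines (x : Cl n) (σ : Equiv.Perm (Fin n)) : Prop :=
  ∀ j, x * gen j = gen (σ j) * x

theorem Intertwines.one : Intertwines (1 : Cl n) 1 := fun j => by simp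

theorem Intertwines.mul {x y : Cl n} {σ τ : Equiv.Perm (Fin n)} (hx : Intertwines x σ)
    (hy : Intertwines y τ) : Intertwines (x * y) (σ * τ) := fun j => by
  rw [mul_assoc, hy j, ← mul_assoc, hx, mul_assoc, Equiv.Perm.mul_apply]

theorem Intertwines.pow {x : Cl n} {σ : Equiv.Perm (Fin n)} (hx : Intertwines x σ) (N : ℕ) :
    Intertwines (x ^ N) (σ ^ N) := by
  induction N with
  | zero => simpa using Intertwines.one
  | succ N ih => rw [pow_succ, pow_succ]; exact ih.mul hx

theorem Intertwines.eq_algebraMap {x : Cl n} (hx : Intertwines x 1)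
    (he : x ∈ even (stdForm n)) : ∃ r : ℝ, x = algebraMap ℝ _ r :=
  eq_algebraMap_of_commute he hx

/-- Two even elements with the same action, one of them an edge product, are proportional. -/
theorem Intertwines.eq_smul_edgeProd {x : Cl n} {σ : Equiv.Perm (Fin n)}
    {L : List (Fin n × Fin n)} (hL : ∀ p ∈ L, p.1 ≠ p.2) (hx : Intertwines x σ)
    (he : x ∈ even (stdForm n)) (hy : Intertwines (edgeProd L) σ) :
    ∃ r : ℝ, x = r • edgeProd L := by
  obtain ⟨u, hu⟩ := isUnit_edgeProd hL
  have h1 : ∀ j, (↑u⁻¹ : Cl n) * gen (σ j) = gen j * (↑u⁻¹ : Cl n) := fun j => by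
    rw [Units.inv_mul_eq_iff_eq_mul, ← mul_assoc, Units.eq_mul_inv_iff_mul_eq, hu, hy j]
  have h2 : (2 ^ L.length : ℝ) • (↑u⁻¹ : Cl n) = star (edgeProd L) := by
    rw [Algebra.smul_def, ← star_mul_edgeProd hL, ← hu, mul_assoc, Units.mul_inv, mul_one]
  have h3 : (↑u⁻¹ : Cl n) ∈ even (stdForm n) := by
    have h4 : (↑u⁻¹ : Cl n) = (2 ^ L.length : ℝ)⁻¹ • star (edgeProd L) := by
      rw [← h2, smul_smul, inv_mul_cancel₀ (by positivity), one_smul]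
    rw [h4]
    refine (even (stdForm n)).smul_mem ?_ _
    change star (edgeProd L) ∈ evenOdd _ 0
    rw [star_def, reverse_mem_evenOdd_iff, involute_mem_evenOdd_iff]
    exact edgeProd_mem_even L
  obtain ⟨r, hr⟩ := eq_algebraMap_of_commute (x := ↑u⁻¹ * x) (mul_mem h3 he) fun j => by
    change _ * _ = _ * _
    rw [mul_assoc, hx j, ← mul_assoc, h1, mul_assoc]
  refine ⟨r, ?_⟩
  rw [Units.inv_mul_eq_iff_eq_mul] at hr
  rw [hr, Algebra.smul_def, Algebra.commutes, hu]

theorem edgeFactor_mul_gen_fst {a b : Fin n} :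
    edgeFactor (a, b) * gen a = gen b * edgeFactor (a, b) := by
  rw [edgeFactor, add_mul, mul_add, one_mul, mul_one, mul_assoc, gen_mul_self, mul_one,
    gen_mul_gen_mul, add_comm]

theorem edgeFactor_mul_gen_snd {a b : Fin n} (h : a ≠ b) :
    edgeFactor (a, b) * gen b = -gen a * edgeFactor (a, b) := by
  rw [edgeFactor, add_mul, mul_add, one_mul, mul_one, mul_assoc, gen_anticomm h, mul_neg,
    gen_mul_gen_mul, neg_mul, gen_anticomm h.symm, mul_neg, neg_neg, gen_mul_gen_mul, add_comm]

theorem edgeFactor_mul_gen_of_ne {a b j : Fin n} (ha : j ≠ a) (hb : j ≠ b) :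
    edgeFactor (a, b) * gen j = gen j * edgeFactor (a, b) :=
  commute_gen_of_genConj (genConj_edgeFactor_of_ne ha hb)

theorem intertwines_threeCycle {a b c : Fin n} (hab : a ≠ b) (hac : a ≠ c) (hbc : b ≠ c) :
    Intertwines (edgeFactor (a, b) * edgeFactor (b, c)) (Equiv.swap a b * Equiv.swap b c) := by
  intro j
  rw [Equiv.Perm.mul_apply]
  by_cases ha : j = a
  · subst ha
    rw [Equiv.swap_apply_of_ne_of_ne hab hac, Equiv.swap_apply_left, mul_assoc,
      edgeFactor_mul_gen_of_ne hab hac, ← mul_assoc, edgeFactor_mul_gen_fst, mul_assoc]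
  by_cases hb : j = b
  · subst hb
    rw [Equiv.swap_apply_left, Equiv.swap_apply_of_ne_of_ne hac.symm hbc.symm, mul_assoc,
      edgeFactor_mul_gen_fst, ← mul_assoc, edgeFactor_mul_gen_of_ne hac.symm hbc.symm, mul_assoc]
  by_cases hc : j = c
  · subst hc
    rw [Equiv.swap_apply_right, Equiv.swap_apply_right, mul_assoc,
      edgeFactor_mul_gen_snd hbc, ← mul_assoc, mul_neg, edgeFactor_mul_gen_snd hab, neg_mul,
      neg_mul, neg_mul, neg_neg, mul_assoc]
  · rw [Equiv.swap_apply_of_ne_of_ne hb hc, Equiv.swap_apply_of_ne_of_ne ha hb, mul_assoc,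
      edgeFactor_mul_gen_of_ne hb hc, ← mul_assoc, edgeFactor_mul_gen_of_ne ha hb, mul_assoc]

/-! ### Paths -/

/-- The edges of the path through the entries of a list. -/
def pathEdges : List (Fin n) → List (Fin n × Fin n)
  | a :: b :: l => (a, b) :: pathEdges (b :: l)
  | _ => []

theorem length_pathEdges (l : List (Fin n)) : (pathEdges l).length = l.length - 1 := by
  induction l with
  | nil => rfl
  | cons a l ih =>
    cases l with
    | nil => rfl
    | cons b l => rw [pathEdges, List.length_cons, ih]; simp

theorem mem_of_mem_pathEdges {l : List (Fin n)} {p : Fin n × Fin n} (h : p ∈ pathEdges l) :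
    p.1 ∈ l ∧ p.2 ∈ l := by
  induction l with
  | nil => simp [pathEdges] at h
  | cons a l ih =>
    cases l with
    | nil => simp [pathEdges] at h
    | cons b l =>
      rw [pathEdges, List.mem_cons] at h
      rcases h with rfl | h
      · simp
      · exact ⟨List.mem_cons_of_mem _ (ih h).1, List.mem_cons_of_mem _ (ih h).2⟩

theorem ne_of_mem_pathEdges {l : List (Fin n)} (hl : l.Nodup) {p : Fin n × Fin n}
    (h : p ∈ pathEdges l) : p.1 ≠ p.2 := by
  induction l with
  | nil => simp [pathEdges] at h
  | cons a l ih =>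
    cases l with
    | nil => simp [pathEdges] at h
    | cons b l =>
      rw [pathEdges, List.mem_cons] at h
      rcases h with rfl | h
      · exact fun e => (List.nodup_cons.1 hl).1 (List.mem_cons.2 (Or.inl e))
      · exact ih (List.nodup_cons.1 hl).2 h

theorem eqvGen_pathEdges {a : Fin n} {l : List (Fin n)} {x : Fin n} (hx : x ∈ a :: l) :
    Relation.EqvGen (fun u v => (u, v) ∈ pathEdges (a :: l)) a x := by
  induction l generalizing a with
  | nil =>
    obtain rfl : x = a := by simpa using hx
    exact .refl _
  | cons b l ih =>
    rcases List.mem_cons.1 hx with rfl | hx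
    · exact .refl _
    · refine .trans _ b _ (.rel _ _ (by simp [pathEdges])) ((ih hx).mono fun u v h => ?_)
      rw [pathEdges]
      exact List.mem_cons_of_mem _ h

theorem intertwines_path (l : List (Fin n)) (hl : l.Nodup) (ho : Odd l.length) :
    Intertwines (edgeProd (pathEdges l)) l.formPerm := by
  induction hk : l.length using Nat.strong_induction_on generalizing l with
  | _ k ih =>
    subst hk
    match l with
    | [] => simp at ho
    | [a] => simpa [pathEdges, edgeProd_nil] using Intertwines.one
    | [a, b] => exact absurd ho (by simp)
    | a :: b :: c :: l =>
      rw [pathEdges, pathEdges, edgeProd_cons, edgeProd_cons, List.formPerm_cons_cons,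
        List.formPerm_cons_cons, ← mul_assoc, ← mul_assoc]
      simp only [List.nodup_cons, List.mem_cons, not_or] at hl
      refine (intertwines_threeCycle hl.1.1 hl.1.2.1 hl.2.1.1).mul
        (ih _ (by simp) (c :: l) (by simpa using hl.2.2) ?_ rfl)
      simp only [List.length_cons] at ho ⊢
      rcases ho with ⟨m, hm⟩
      exact ⟨m - 1, by omega⟩

theorem genConj_path_of_notMem {a : Fin n} {l : List (Fin n)} (h : a ∉ l) :
    genConj a (edgeProd (pathEdges l)) = edgeProd (pathEdges l) :=
  genConj_edgeProd_of_ne fun _ hp =>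
    ⟨fun e => h (e ▸ (mem_of_mem_pathEdges hp).1), fun e => h (e ▸ (mem_of_mem_pathEdges hp).2)⟩

theorem genConj_gen_mul_gen {a b : Fin n} (h : a ≠ b) :
    genConj a (gen b * gen a) = -(gen b * gen a) := by
  rw [map_mul, genConj_gen_self, genConj_gen_of_ne h, neg_mul]

theorem scalarPart_path {l : List (Fin n)} (hl : l.Nodup) :
    scalarPart n (edgeProd (pathEdges l)) = 1 := by
  induction l with
  | nil => exact scalarPart_one
  | cons a l ih =>
    cases l with
    | nil => exact scalarPart_one
    | cons b l =>
      have h := List.nodup_cons.1 hl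
      have hab : a ≠ b := fun e => h.1 (e ▸ List.mem_cons_self)
      rw [pathEdges, edgeProd_cons, edgeFactor, add_mul, one_mul, map_add, ih h.2,
        scalarPart_eq_zero (i := a), add_zero]
      rw [map_mul, genConj_gen_mul_gen hab, genConj_path_of_notMem h.1, neg_mul]

/-- The scalar part of the square of a path product. -/
theorem scalarPart_path_sq {a : Fin n} {l : List (Fin n)} (hl : (a :: l).Nodup) :
    scalarPart n (edgeProd (pathEdges (a :: l)) * edgeProd (pathEdges (a :: l))) =
        algebraMap ℝ _ ((1 + Complex.I) ^ (a :: l).length).re ∧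
      scalarPart n (genConj a (edgeProd (pathEdges (a :: l))) * edgeProd (pathEdges (a :: l))) =
        algebraMap ℝ _ ((1 + Complex.I) ^ (a :: l).length).im := by
  induction l generalizing a with
  | nil => simp [pathEdges, edgeProd_nil, scalarPart_one]
  | cons b l ih =>
    have h := List.nodup_cons.1 hl
    have hab : a ≠ b := fun e => h.1 (e ▸ List.mem_cons_self)
    obtain ⟨ih1, ih2⟩ := ih h.2
    have hz := genConj_path_of_notMem h.1
    have hf := genConj_gen_mul_gen hab
    rw [pathEdges, edgeProd_cons, edgeFactor, List.length_cons, pow_succ']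
    set z := edgeProd (pathEdges (b :: l))
    set w := (1 + Complex.I) ^ (b :: l).length
    have hre : ((1 + Complex.I) * w).re = w.re - w.im := by simp
    have him : ((1 + Complex.I) * w).im = w.re + w.im := by simp; ring
    have hfzf : (gen b * gen a) * z * ((gen b * gen a) * z) = -(genConj b z * z) := by
      have h1 : gen a * z = z * gen a := (commute_gen_of_genConj hz).symm
      calc (gen b * gen a) * z * ((gen b * gen a) * z)
          = gen b * (gen a * z) * (gen b * gen a) * z := by simp only [mul_assoc]
        _ = gen b * z * (gen a * (gen b * gen a)) * z := by rw [h1]; simp only [mul_assoc]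
        _ = -(genConj b z * z) := by
          rw [← mul_assoc (gen a), gen_anticomm hab, neg_mul, mul_assoc (gen b) (gen a),
            gen_mul_self, genConj_apply]
          simp only [mul_one, mul_neg, neg_mul]
    set f := gen b * gen a
    have hzf : scalarPart n (z * (f * z)) = 0 :=
      scalarPart_eq_zero (i := a) (by rw [map_mul, map_mul, hz, hf, neg_mul, mul_neg])
    have hfz : scalarPart n (f * z * z) = 0 :=
      scalarPart_eq_zero (i := a) (by rw [map_mul, map_mul, hz, hf, neg_mul, neg_mul])
    constructor
    · rw [hre, map_sub, ← ih1, ← ih2, add_mul, one_mul, add_mul, mul_add, mul_add, hfzf, map_add,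
        map_add, map_add, hzf, hfz, map_neg]
      abel
    · rw [him, map_add, ← ih1, ← ih2, map_mul (genConj a), map_add (genConj a), map_one,
        hf, hz, add_mul, add_mul, one_mul,
        neg_mul, add_mul, mul_add, mul_add, neg_mul, neg_mul, hfzf, map_add,
        map_add, map_add, hzf, map_neg, one_mul, hfz]
      simp

/-! ### Relabelling -/

/-- The automorphism of the Clifford algebra given by a permutation of the basis vectors. -/
noncomputable def relabel (τ : Equiv.Perm (Fin n)) : Cl n →ₐ[ℝ] Cl n :=
  CliffordAlgebra.map
    { toLinearMap := LinearMap.funLeft ℝ ℝ τ.symm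
      map_app' := fun v => by
        change stdForm n (fun i => v (τ.symm i)) = stdForm n v
        rw [stdForm_apply, stdForm_apply]
        exact Equiv.sum_comp τ.symm fun i => v i * v i }

theorem relabel_gen (τ : Equiv.Perm (Fin n)) (i : Fin n) : relabel τ (gen i) = gen (τ i) := by
  rw [relabel, gen, map_apply_ι, gen]
  congr 1
  funext j
  change (Pi.single i 1 : Fin n → ℝ) (τ.symm j) = _
  simp only [Pi.single_apply, Equiv.symm_apply_eq]

theorem relabel_path (τ : Equiv.Perm (Fin n)) (l : List (Fin n)) :
    relabel τ (edgeProd (pathEdges l)) = edgeProd (pathEdges (l.map τ)) := by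
  induction l with
  | nil => simp [pathEdges, edgeProd_nil]
  | cons a l ih =>
    cases l with
    | nil => simp [pathEdges, edgeProd_nil]
    | cons b l =>
      rw [List.map_cons] at ih
      rw [List.map_cons, List.map_cons, pathEdges, pathEdges, edgeProd_cons, edgeProd_cons,
        map_mul, ih, edgeFactor, edgeFactor, map_add, map_one, map_mul, relabel_gen, relabel_gen]

theorem Intertwines.relabel {x : Cl n} {σ : Equiv.Perm (Fin n)} (hx : Intertwines x σ)
    (τ : Equiv.Perm (Fin n)) : Intertwines (relabel τ x) (τ * σ * τ⁻¹) := fun j => by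
  have h := congrArg (SpinLift.relabel τ) (hx (τ⁻¹ j))
  rw [map_mul, map_mul, relabel_gen, relabel_gen] at h
  simpa using h

/-! ### Odd powers of `1 + i` -/

theorem one_add_I_pow_four : (1 + Complex.I) ^ 4 = ((-4 : ℝ) : ℂ) := by
  have h : (1 + Complex.I) ^ 2 = 2 * Complex.I := by
    rw [add_sq, Complex.I_sq]; ring
  rw [show 4 = 2 * 2 by norm_num, pow_mul, h, mul_pow, Complex.I_sq]
  norm_num

theorem re_one_add_I_pow (j : ℕ) :
    ((1 + Complex.I) ^ (2 * j + 1)).re = (-1) ^ (((2 * j + 1) ^ 2 - 1) / 8) * 2 ^ j := by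
  have hexp : ∀ j : ℕ, ((2 * j + 1) ^ 2 - 1) / 8 = j * (j + 1) / 2 := fun j => by
    rw [show (2 * j + 1) ^ 2 - 1 = 4 * (j * (j + 1)) by
      rw [Nat.sub_eq_iff_eq_add (Nat.one_le_pow _ _ (by omega))]; ring,
      show 8 = 4 * 2 by norm_num, Nat.mul_div_mul_left _ _ (by norm_num)]
  rw [hexp]
  induction j using Nat.twoStepInduction with
  | zero => simp
  | one =>
    have h : (1 + Complex.I) ^ 3 = ⟨-2, 2⟩ := by
      apply Complex.ext <;> simp [pow_succ] <;> norm_num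
    norm_num [h]
  | more j ih _ =>
    rw [show 2 * (j + 2) + 1 = 4 + (2 * j + 1) by ring, pow_add, one_add_I_pow_four,
      Complex.re_ofReal_mul, ih,
      show (j + 2) * (j + 2 + 1) = j * (j + 1) + (2 * j + 3) * 2 by ring,
      Nat.add_mul_div_right _ _ (by norm_num), pow_add (-1 : ℝ), pow_add (2 : ℝ),
      Odd.neg_one_pow (n := 2 * j + 3) ⟨j + 1, by ring⟩]
    ring

/-- The factor by which the edge product of a permutation with given cycle lengths differs from
the lift of the same order. -/
noncomputable def liftScale (m : Multiset ℕ) : ℝ :=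
  (m.map fun k => ((1 + Complex.I) ^ k).re).prod

theorem liftScale_eq {m : Multiset ℕ} (hm : ∀ k ∈ m, Odd k) :
    liftScale m = (-1) ^ (m.map fun k => (k ^ 2 - 1) / 8).sum *
      2 ^ (m.map fun k => (k - 1) / 2).sum := by
  induction m using Multiset.induction_on with
  | empty => simp [liftScale]
  | cons k m ih =>
    obtain ⟨j, rfl⟩ := hm k (Multiset.mem_cons_self _ _)
    have h := ih fun i hi => hm i (Multiset.mem_cons_of_mem hi)
    rw [liftScale] at h ⊢
    rw [Multiset.map_cons, Multiset.prod_cons, h, re_one_add_I_pow, Multiset.map_cons,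
      Multiset.sum_cons, Multiset.map_cons, Multiset.sum_cons, pow_add, pow_add,
      show (2 * j + 1 - 1) / 2 = j by omega]
    ring

theorem two_mul_sum_half {m : Multiset ℕ} (hm : ∀ k ∈ m, Odd k) :
    2 * (m.map fun k => (k - 1) / 2).sum = (m.map fun k => k - 1).sum := by
  rw [← Multiset.sum_map_mul_left]
  refine congrArg _ (Multiset.map_congr rfl fun k hk => ?_)
  obtain ⟨j, rfl⟩ := hm k hk
  omega

theorem liftScale_sq {m : Multiset ℕ} (hm : ∀ k ∈ m, Odd k) :
    liftScale m ^ 2 = 2 ^ (m.map fun k => k - 1).sum := by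
  rw [liftScale_eq hm, ← two_mul_sum_half hm, mul_pow, pow_right_comm, ← pow_mul (2 : ℝ),
    mul_comm 2]
  norm_num

theorem liftScale_ne_zero {m : Multiset ℕ} (hm : ∀ k ∈ m, Odd k) : liftScale m ≠ 0 := by
  intro h
  have := liftScale_sq hm
  rw [h] at this
  exact (pow_pos (two_pos : (0 : ℝ) < 2) _).ne (by simpa using this)

theorem odd_of_mem_cycleType {σ : Equiv.Perm (Fin n)} (h : Odd (orderOf σ)) :
    ∀ k ∈ σ.cycleType, Odd k := fun _ hk =>
  h.of_dvd_nat (Equiv.Perm.dvd_of_mem_cycleType hk)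

/-! ### The edge product of a permutation of odd order -/

/-- The path product of a cycle of odd length `k` has a scalar `k`-th power. -/
theorem path_pow_length {l : List (Fin n)} (hl : l.Nodup) (ho : Odd l.length) :
    edgeProd (pathEdges l) ^ l.length =
      algebraMap ℝ _ (((1 + Complex.I) ^ l.length).re ^ l.length) := by
  rcases eq_or_ne l.length 1 with h1 | h1
  · obtain ⟨a, rfl⟩ := List.length_eq_one_iff.1 h1
    simp [pathEdges, edgeProd_nil]
  obtain ⟨a, t, hat⟩ : ∃ a t, l = a :: t := List.exists_cons_of_ne_nil (by rintro rfl; simp at ho)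
  have hlen : 2 ≤ l.length := by
    rcases ho with ⟨m, hm⟩
    omega
  set σ := l.formPerm with hσ
  have hcyc : σ.IsCycle := List.isCycle_formPerm hl hlen
  have hord : orderOf σ = l.length := by
    rw [hcyc.orderOf, hσ, List.support_formPerm_of_nodup l hl, List.toFinset_card_of_nodup hl]
    intro x hx
    rw [hx] at h1
    exact h1 rfl
  have hcop : Nat.Coprime 2 (orderOf σ) := by
    rw [hord]
    exact (Nat.coprime_two_left).2 ho
  have hconj : IsConj σ (σ ^ 2) := by
    have h2 : (σ ^ 2).IsCycle := hcyc.pow_iff.2 hcop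
    rw [Equiv.Perm.isConj_iff_cycleType_eq, hcyc.cycleType, h2.cycleType, ← hcyc.orderOf,
      ← h2.orderOf, hcop.symm.orderOf_pow]
  obtain ⟨τ, hτ⟩ := isConj_iff.1 hconj
  have hy := intertwines_path l hl ho
  have hne : ∀ p ∈ pathEdges l, p.1 ≠ p.2 := fun p hp => ne_of_mem_pathEdges hl hp
  have hl' : (l.map τ).Nodup := hl.map τ.injective
  have hne' : ∀ p ∈ pathEdges (l.map τ), p.1 ≠ p.2 := fun p hp => ne_of_mem_pathEdges hl' hp
  have hy' := hy.relabel τ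
  rw [← hσ, hτ, relabel_path] at hy'
  have hev := edgeProd_mem_even (pathEdges l)
  obtain ⟨r, hr⟩ := Intertwines.eq_smul_edgeProd hne' (hy.pow 2) (pow_mem hev 2) hy'
  have hrA : r = ((1 + Complex.I) ^ l.length).re := by
    have h2 := congrArg (scalarPart n) hr
    rw [map_smul, scalarPart_path hl', ← Algebra.algebraMap_eq_smul_one, pow_two, hat,
      (scalarPart_path_sq (hat ▸ hl)).1] at h2
    rw [hat]
    exact (algebraMap_Cl_injective h2).symm
  have hpow := hy.pow l.length
  rw [← hσ, ← hord, pow_orderOf_eq_one, hord] at hpow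
  obtain ⟨ρ, hρ⟩ := hpow.eq_algebraMap (pow_mem hev _)
  have hρ' : edgeProd (pathEdges (l.map τ)) ^ l.length = algebraMap ℝ _ ρ := by
    rw [← relabel_path, ← map_pow, hρ, AlgHom.commutes]
  have hρ0 : ρ ≠ 0 := by
    rintro rfl
    have h2 := (isUnit_edgeProd hne).pow l.length
    rw [hρ, map_zero] at h2
    exact not_isUnit_zero h2
  have h3 : ρ ^ 2 = r ^ l.length * ρ := by
    apply algebraMap_Cl_injective (n := n)
    rw [map_mul, map_pow, ← hρ, ← pow_mul, mul_comm, pow_mul, hr, smul_pow, hρ, hρ',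
      Algebra.smul_def]
  rw [hρ, ← hrA]
  congr 1
  rw [pow_two] at h3
  exact mul_right_cancel₀ hρ0 h3

/-- A list of edges whose edge product is a multiple of the lift of `σ` of the same order. -/
structure IsEdgeSystem (σ : Equiv.Perm (Fin n)) (L : List (Fin n × Fin n)) : Prop where
  length_eq : L.length = (σ.cycleType.map fun u => u - 1).sum
  ne : ∀ p ∈ L, p.1 ≠ p.2
  moved : ∀ p ∈ L, σ p.1 ≠ p.1 ∧ σ p.2 ≠ p.2
  eqvGen : ∀ x, Relation.EqvGen (fun a b => (a, b) ∈ L) x (σ x)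
  intertwines : Intertwines (edgeProd L) σ
  pow_eq : ∀ N, σ ^ N = 1 → edgeProd L ^ N = algebraMap ℝ _ (liftScale σ.cycleType ^ N)

theorem IsEdgeSystem.one : IsEdgeSystem (1 : Equiv.Perm (Fin n)) [] where
  length_eq := by simp
  ne := by simp
  moved := by simp
  eqvGen := fun x => .refl _
  intertwines := .one
  pow_eq := by simp [edgeProd_nil, liftScale]

theorem IsEdgeSystem.of_isCycle {σ : Equiv.Perm (Fin n)} (hσ : σ.IsCycle)
    (ho : Odd (orderOf σ)) : ∃ L, IsEdgeSystem σ L := by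
  obtain ⟨x, hx, -⟩ := id hσ
  set l := σ.toList x with hl
  have hx' : x ∈ σ.support := Equiv.Perm.mem_support.2 hx
  have hperm : l.formPerm = σ := by rw [hl, Equiv.Perm.formPerm_toList, hσ.cycleOf_eq hx]
  have hnd : l.Nodup := Equiv.Perm.nodup_toList _ _
  have hlen : l.length = orderOf σ := by
    rw [hl, Equiv.Perm.length_toList, hσ.cycleOf_eq hx, hσ.orderOf]
  have hmem : ∀ y, y ∈ l ↔ σ y ≠ y := fun y => by
    rw [hl, Equiv.Perm.mem_toList_iff]
    exact ⟨fun h => Equiv.Perm.mem_support.1 (h.1.mem_support_iff.1 h.2),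
      fun h => ⟨hσ.sameCycle hx h, hx'⟩⟩
  have hol : Odd l.length := hlen ▸ ho
  have hct : σ.cycleType = {l.length} := by rw [hσ.cycleType, hlen, hσ.orderOf]
  refine ⟨pathEdges l, ?_, fun p hp => ne_of_mem_pathEdges hnd hp, fun p hp => ?_, fun y => ?_, ?_,
    fun N hN => ?_⟩
  · simp [length_pathEdges, hct]
  · exact ⟨(hmem _).1 (mem_of_mem_pathEdges hp).1, (hmem _).1 (mem_of_mem_pathEdges hp).2⟩
  · by_cases hy : σ y = y
    · rw [hy]
      exact .refl _
    · have h1 : y ∈ l := (hmem _).2 hy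
      have h2 : σ y ∈ l := (hmem _).2 fun h => hy (σ.injective h)
      obtain ⟨a, t, hat⟩ : ∃ a t, l = a :: t := List.exists_cons_of_ne_nil (List.ne_nil_of_mem h1)
      rw [hat] at h1 h2 ⊢
      exact .trans _ a _ (.symm _ _ (eqvGen_pathEdges h1)) (eqvGen_pathEdges h2)
  · have := intertwines_path l hnd hol
    rwa [hperm] at this
  · obtain ⟨m, rfl⟩ := hlen ▸ orderOf_dvd_of_pow_eq_one hN
    rw [pow_mul, path_pow_length hnd hol, ← map_pow, hct, liftScale, pow_mul]
    simp

theorem IsEdgeSystem.mul {σ τ : Equiv.Perm (Fin n)} {L K : List (Fin n × Fin n)}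
    (hd : σ.Disjoint τ) (hL : IsEdgeSystem σ L) (hK : IsEdgeSystem τ K) :
    IsEdgeSystem (σ * τ) (L ++ K) where
  length_eq := by
    rw [List.length_append, hL.length_eq, hK.length_eq, hd.cycleType_mul, Multiset.map_add,
      Multiset.sum_add]
  ne p hp := (List.mem_append.1 hp).elim (hL.ne p) (hK.ne p)
  moved p hp := by
    have h : ∀ x, σ x ≠ x ∨ τ x ≠ x → (σ * τ) x ≠ x := fun x hx h => by
      have := (hd.mul_apply_eq_iff).1 h
      tauto
    rcases List.mem_append.1 hp with hp | hp
    · exact ⟨h _ (Or.inl (hL.moved p hp).1), h _ (Or.inl (hL.moved p hp).2)⟩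
    · exact ⟨h _ (Or.inr (hK.moved p hp).1), h _ (Or.inr (hK.moved p hp).2)⟩
  eqvGen x := .trans _ (τ x) _
    ((hK.eqvGen x).mono fun _ _ h => List.mem_append.2 (Or.inr h))
    ((hL.eqvGen (τ x)).mono fun _ _ h => List.mem_append.2 (Or.inl h))
  intertwines := by
    rw [edgeProd_append]
    exact hL.intertwines.mul hK.intertwines
  pow_eq N hN := by
    have hcomm : Commute (edgeProd L) (edgeProd K) := by
      refine Commute.list_prod_right _ _ fun y hy => ?_
      obtain ⟨p, hp, rfl⟩ := List.mem_map.1 hy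
      have h : ∀ x, τ x ≠ x → Commute (edgeProd L) (gen x) := fun x hx => by
        have h1 := hL.intertwines x
        rwa [(hd x).resolve_right hx] at h1
      exact (Commute.one_right _).add_right
        ((h _ (hK.moved p hp).2).mul_right (h _ (hK.moved p hp).1))
    rw [hd.commute.mul_pow, (hd.pow_disjoint_pow N N).mul_eq_one_iff] at hN
    rw [edgeProd_append, hcomm.mul_pow, hL.pow_eq N hN.1, hK.pow_eq N hN.2, ← map_mul,
      hd.cycleType_mul, ← mul_pow]
    simp [liftScale]

theorem exists_isEdgeSystem {σ : Equiv.Perm (Fin n)} (ho : Odd (orderOf σ)) :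
    ∃ L, IsEdgeSystem σ L := by
  induction σ using Equiv.Perm.cycle_induction_on with
  | base_one => exact ⟨[], .one⟩
  | base_cycles σ hσ => exact IsEdgeSystem.of_isCycle hσ ho
  | induction_disjoint σ τ hd _ ihσ ihτ =>
    rw [hd.orderOf] at ho
    obtain ⟨L, hL⟩ := ihσ (ho.of_dvd_nat (Nat.dvd_lcm_left _ _))
    obtain ⟨K, hK⟩ := ihτ (ho.of_dvd_nat (Nat.dvd_lcm_right _ _))
    exact ⟨L ++ K, hL.mul hd hK⟩

/-! ### Expansion of an edge product over the even subgraphs -/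

theorem exists_expansion (L : List (Fin n × Fin n)) :
    ∃ (T : Type) (_ : AddCommGroup T) (_ : Fintype T) (φ : T →+ (Fin n → ZMod 2))
      (w : T → List (Fin n)), Fintype.card T = 2 ^ L.length ∧ w 0 = [] ∧
      (∀ t, Even (w t).length) ∧ (∀ t i, ((w t).count i : ZMod 2) = φ t i) ∧
      edgeProd L = ∑ t, word (w t) ∧
      ∀ p ∈ L, (Pi.single p.1 1 + Pi.single p.2 1 : Fin n → ZMod 2) ∈ φ.range := by
  induction L with
  | nil =>
    refine ⟨Unit, inferInstance, inferInstance, 0, fun _ => [], by simp, rfl, by simp, by simp, ?_,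
      by simp⟩
    simp [edgeProd_nil, word_nil]
  | cons p L ih =>
    obtain ⟨T, _, _, φ, w, hcard, hw0, hev, hcount, hsum, hrange⟩ := ih
    let v : Fin n → ZMod 2 := Pi.single p.1 1 + Pi.single p.2 1
    let ψ : ZMod 2 →+ (Fin n → ZMod 2) :=
      (LinearMap.toSpanSingleton (ZMod 2) (Fin n → ZMod 2) v).toAddMonoidHom
    have hψ : ∀ z, ψ z = z • v := fun z => rfl
    refine ⟨ZMod 2 × T, inferInstance, inferInstance, ψ.coprod φ,
      fun t => if t.1 = 0 then w t.2 else p.2 :: p.1 :: w t.2, ?_, ?_, ?_, ?_, ?_, ?_⟩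
    · rw [Fintype.card_prod, hcard, ZMod.card, List.length_cons, pow_succ']
    · simpa using hw0
    · rintro ⟨z, t⟩
      dsimp only
      split_ifs
      · exact hev t
      · rw [List.length_cons, List.length_cons, add_assoc]
        exact (hev t).add even_two
    · rintro ⟨z, t⟩ i
      rw [AddMonoidHom.coprod_apply, hψ, Pi.add_apply, ← hcount]
      obtain rfl | rfl : z = 0 ∨ z = 1 := by revert z; decide
      · simp
      · change ((List.count i (p.2 :: p.1 :: w t) : ℕ) : ZMod 2) = ((1 : ZMod 2) • v) i + _
        rw [one_smul]
        simp only [v, List.count_cons, Pi.add_apply, Pi.single_apply, beq_iff_eq, eq_comm (a := i)]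
        push_cast
        ring
    · rw [Fintype.sum_prod_type]
      have h2 : ∀ f : ZMod 2 → Cl n, ∑ z, f z = f 0 + f 1 := fun f => Fin.sum_univ_two f
      rw [h2]
      simp only [if_true, one_ne_zero, if_false, word_cons]
      rw [edgeProd_cons, edgeFactor, add_mul, one_mul, hsum, Finset.mul_sum]
      simp only [mul_assoc]
    · intro q hq
      rcases List.mem_cons.1 hq with rfl | hq
      · exact ⟨(1, 0), by rw [AddMonoidHom.coprod_apply, hψ, map_zero, add_zero, one_smul]⟩
      · obtain ⟨t, ht⟩ := hrange q hq
        exact ⟨(0, t), by rw [AddMonoidHom.coprod_apply, map_zero, zero_add, ht]⟩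

theorem single_add_single_mem {L : List (Fin n × Fin n)} {R : AddSubgroup (Fin n → ZMod 2)}
    (hR : ∀ p ∈ L, Pi.single p.1 1 + Pi.single p.2 1 ∈ R) {x y : Fin n}
    (h : Relation.EqvGen (fun a b => (a, b) ∈ L) x y) : Pi.single x 1 + Pi.single y 1 ∈ R := by
  have h2 : ∀ u : Fin n → ZMod 2, u + u = 0 := fun u => funext fun i => CharTwo.add_self_eq_zero _
  induction h with
  | rel x y h => exact hR _ h
  | refl x =>
    rw [h2]
    exact R.zero_mem
  | symm x y _ ih => rwa [add_comm]
  | trans x y z _ _ ih1 ih2 =>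
    have := R.add_mem ih1 ih2
    rwa [add_assoc, ← add_assoc (Pi.single y 1), h2, zero_add] at this

theorem two_pow_le_card {R : AddSubgroup (Fin n → ZMod 2)} (x₀ : Fin n)
    (hR : ∀ x y, Pi.single x 1 + Pi.single y 1 ∈ R) : 2 ^ n ≤ 2 * Nat.card R := by
  have hs : Function.Surjective
      fun c : ZMod 2 × R => c.1 • (Pi.single x₀ 1 : Fin n → ZMod 2) + c.2 := by
    intro v
    have hmem : ∑ i, v i • (Pi.single i 1 + Pi.single x₀ 1 : Fin n → ZMod 2) ∈ R := by
      refine R.sum_mem fun i _ => ?_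
      obtain h | h : v i = 0 ∨ v i = 1 := by generalize v i = z; revert z; decide
      · rw [h, zero_smul]
        exact R.zero_mem
      · rw [h, one_smul]
        exact hR i x₀
    refine ⟨(∑ i, v i, ⟨_, hmem⟩), ?_⟩
    simp only [smul_add, Finset.sum_add_distrib, ← Finset.sum_smul]
    have h1 : ∑ i, v i • (Pi.single i 1 : Fin n → ZMod 2) = v := by
      funext j
      simp [Finset.sum_apply, Pi.single_apply]
    rw [h1, add_left_comm]
    exact add_eq_left.2 (funext fun i => by
      rw [Pi.add_apply, CharTwo.add_self_eq_zero, Pi.zero_apply])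
  have h := Nat.card_le_card_of_surjective _ hs
  rwa [Nat.card_prod, Nat.card_zmod, Nat.card_fun, Nat.card_zmod, Nat.card_fin] at h

/-- A scalar edge product over a connected graph is bounded below. -/
theorem neg_lt_of_edgeProd_eq {L : List (Fin n × Fin n)} (x₀ : Fin n)
    (hL : ∀ x y, Relation.EqvGen (fun a b => (a, b) ∈ L) x y) {r : ℝ}
    (hr : edgeProd L = algebraMap ℝ _ r) {k : ℕ} (hk : L.length + 1 = n + k) : -2 ^ k < r := by
  classical
  obtain ⟨T, _, _, φ, w, hcard, hw0, hev, hcount, hsum, hrange⟩ := exists_expansion L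
  choose ρ hρ hρge hρ0 hρ1 using fun t => scalarPart_word (hev t)
  have hrsum : r = ∑ t, ρ t := by
    apply algebraMap_Cl_injective (n := n)
    rw [map_sum, ← scalarPart_algebraMap r, ← hr, hsum, map_sum]
    exact Finset.sum_congr rfl fun t _ => hρ t
  have hker : ∑ t, ρ t = ∑ t with φ t = 0, ρ t := by
    refine (Finset.sum_filter_of_ne fun t _ ht => ?_).symm
    by_contra h
    obtain ⟨i, hi⟩ := Function.ne_iff.1 h
    refine ht (hρ0 t ⟨i, ?_⟩)
    rw [← hcount, Pi.zero_apply, Ne, ZMod.natCast_eq_zero_iff_even, Nat.not_even_iff_odd] at hi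
    exact hi
  have hlt : ∑ t with φ t = 0, (-1 : ℝ) < ∑ t with φ t = 0, ρ t := by
    refine Finset.sum_lt_sum (fun t _ => hρge t) ⟨0, by simp, ?_⟩
    rw [hρ1 0 hw0]
    norm_num
  have hcardker : (Finset.univ.filter fun t => φ t = 0).card ≤ 2 ^ k := by
    have h1 : Nat.card φ.ker = (Finset.univ.filter fun t => φ t = 0).card :=
      Nat.subtype_card _ (by simp [AddMonoidHom.mem_ker])
    have h2 : Nat.card φ.range * Nat.card φ.ker = 2 ^ L.length := by
      rw [← hcard, ← Nat.card_eq_fintype_card, φ.ker.card_eq_card_quotient_mul_card_addSubgroup,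
        Nat.card_congr (QuotientAddGroup.quotientKerEquivRange φ).toEquiv]
    have h3 := two_pow_le_card x₀ fun x y => single_add_single_mem hrange (hL x y)
    rw [← h1]
    have h4 : 2 ^ n * Nat.card φ.ker ≤ 2 ^ n * 2 ^ k := by
      calc 2 ^ n * Nat.card φ.ker ≤ 2 * Nat.card φ.range * Nat.card φ.ker :=
            Nat.mul_le_mul_right _ h3
        _ = 2 ^ n * 2 ^ k := by rw [mul_assoc, h2, ← pow_succ', hk, pow_add]
    exact Nat.le_of_mul_le_mul_left h4 (by positivity)
  rw [hrsum, hker]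
  refine lt_of_le_of_lt ?_ hlt
  rw [Finset.sum_const, nsmul_eq_mul, mul_neg_one, neg_le_neg_iff]
  exact_mod_cast hcardker

/-! ### Lifts to the spin cover -/

theorem ι_mem_lipschitz {v : Fin n → ℝ} (h : stdForm n v ≠ 0) :
    ι (stdForm n) v ∈
      (lipschitzGroup (stdForm n)).toSubmonoid.map (Units.coeHom (Cl n)) := by
  obtain ⟨u, hu⟩ := isUnit_ι_of_isUnit (Q := stdForm n) (IsUnit.mk0 _ h)
  exact ⟨u, Subgroup.subset_closure ⟨v, hu.symm⟩, hu⟩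

theorem gen_mem_lipschitz (i : Fin n) :
    gen i ∈ (lipschitzGroup (stdForm n)).toSubmonoid.map (Units.coeHom (Cl n)) := by
  refine ι_mem_lipschitz ?_
  rw [stdForm_apply]
  simp [Pi.single_apply]

theorem smul_edgeProd_mem_lipschitz {L : List (Fin n × Fin n)} (hL : ∀ p ∈ L, p.1 ≠ p.2) {c : ℝ}
    (hc : c ≠ 0) (i : Fin n) : c • edgeProd L ∈
      (lipschitzGroup (stdForm n)).toSubmonoid.map (Units.coeHom (Cl n)) := by
  have h1 : c • edgeProd L = ι (stdForm n) (c • Pi.single i 1) * gen i * edgeProd L := by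
    rw [map_smul, ← gen, smul_mul_assoc, gen_mul_self, smul_mul_assoc, one_mul]
  rw [h1]
  refine mul_mem (mul_mem (ι_mem_lipschitz ?_) (gen_mem_lipschitz i)) (list_prod_mem fun x hx => ?_)
  · rw [stdForm_apply]
    simpa [Pi.single_apply] using hc
  · obtain ⟨p, hp, rfl⟩ := List.mem_map.1 hx
    have h2 : edgeFactor p = ι (stdForm n) (Pi.single p.2 1 + Pi.single p.1 1) * gen p.1 := by
      rw [map_add, ← gen, ← gen, add_mul, gen_mul_self, edgeFactor, add_comm]
    rw [h2]
    refine mul_mem (ι_mem_lipschitz ?_) (gen_mem_lipschitz _)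
    rw [stdForm_apply]
    refine (Finset.sum_pos' (fun _ _ => mul_self_nonneg _) ⟨p.1, Finset.mem_univ _, ?_⟩).ne'
    simp [hL p hp]

theorem smul_edgeProd_mem_spinGroup {L : List (Fin n × Fin n)} (hL : ∀ p ∈ L, p.1 ≠ p.2) {c : ℝ}
    (hc : c ^ 2 * 2 ^ L.length = 1) (i : Fin n) : c • edgeProd L ∈ spinGroup (stdForm n) := by
  have hc0 : c ≠ 0 := by
    rintro rfl
    simp at hc
  refine ⟨⟨smul_edgeProd_mem_lipschitz hL hc0 i, ?_⟩, (even (stdForm n)).smul_mem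
    (edgeProd_mem_even L) c⟩
  rw [SetLike.mem_coe, Unitary.mem_iff, CliffordAlgebra.star_smul, smul_mul_smul_comm,
    smul_mul_smul_comm, star_mul_edgeProd hL, edgeProd_mul_star hL, Algebra.smul_def, ← map_mul,
    ← pow_two, hc, map_one]
  exact ⟨rfl, rfl⟩

theorem permVec_single (σ : Equiv.Perm (Fin n)) (j : Fin n) :
    permVec σ (Pi.single j 1) = Pi.single (σ j) 1 := by
  funext i
  simp only [permVec, Pi.single_apply, Equiv.Perm.inv_eq_iff_eq]

theorem mem_spinCover_iff (p : spinGroup (stdForm n) × alternatingGroup (Fin n)) :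
    p ∈ spinCover n ↔ Intertwines (p.1 : Cl n) (p.2 : Equiv.Perm (Fin n)) := by
  have hl : ((p.1⁻¹ : spinGroup (stdForm n)) : Cl n) * p.1 = 1 := by
    rw [← Submonoid.coe_mul, inv_mul_cancel, Submonoid.coe_one]
  have hr : (p.1 : Cl n) * ((p.1⁻¹ : spinGroup (stdForm n)) : Cl n) = 1 := by
    rw [← Submonoid.coe_mul, mul_inv_cancel, Submonoid.coe_one]
  constructor
  · intro h j
    have h1 := h (Pi.single j 1)
    rw [permVec_single] at h1
    rw [gen, gen, ← h1, mul_assoc, hl, mul_one]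
  · intro h v
    rw [ι_eq_sum_gen, ι_eq_sum_gen, Finset.mul_sum, Finset.sum_mul,
      ← Equiv.sum_comp (p.2 : Equiv.Perm (Fin n)) fun i => permVec _ v i • gen i]
    refine Finset.sum_congr rfl fun i _ => ?_
    rw [mul_smul_comm, h i, smul_mul_assoc, mul_assoc, hr, mul_one, permVec]
    congr 2
    exact (Equiv.symm_apply_apply _ i).symm

theorem spinVal_one : spinVal (1 : spinCover n) = 1 := rfl

theorem spinVal_mul (x y : spinCover n) : spinVal (x * y) = spinVal x * spinVal y := rfl

theorem spinVal_pow (x : spinCover n) (N : ℕ) : spinVal (x ^ N) = spinVal x ^ N := by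
  induction N with
  | zero => simp [spinVal_one]
  | succ N ih => rw [pow_succ, spinVal_mul, ih, pow_succ]

theorem spinVal_mem_even (x : spinCover n) : spinVal x ∈ even (stdForm n) := x.1.1.2.2

theorem intertwines_spinVal (x : spinCover n) :
    Intertwines (spinVal x) (spinProj n x : Equiv.Perm (Fin n)) :=
  (mem_spinCover_iff x.1).1 x.2

/-- The lift of the same order is a multiple of the edge product. -/
theorem IsSameOrderLift.smul_spinVal {g : alternatingGroup (Fin n)} (hg : Odd (orderOf g))
    {L : List (Fin n × Fin n)} (hL : IsEdgeSystem (g : Equiv.Perm (Fin n)) L) {x : spinCover n}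
    (hx : IsSameOrderLift g x) :
    edgeProd L = liftScale (g : Equiv.Perm (Fin n)).cycleType • spinVal x := by
  have hi := intertwines_spinVal x
  rw [hx.1] at hi
  obtain ⟨r, hr⟩ := hi.eq_smul_edgeProd hL.ne (spinVal_mem_even x) hL.intertwines
  have h1 : spinVal x ^ orderOf g = 1 := by
    rw [← spinVal_pow, ← hx.2, pow_orderOf_eq_one, spinVal_one]
  have h2 : (g : Equiv.Perm (Fin n)) ^ orderOf g = 1 := by
    rw [← Subgroup.coe_pow, pow_orderOf_eq_one, Subgroup.coe_one]
  set s := liftScale (g : Equiv.Perm (Fin n)).cycleType with hs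
  have h3 : (r * s) ^ orderOf g = 1 := by
    apply algebraMap_Cl_injective (n := n)
    rw [map_one, ← h1, hr, smul_pow, hL.pow_eq _ h2, Algebra.smul_def, ← map_mul, mul_pow]
  have h4 : s * r = 1 := by
    rw [mul_comm]
    exact hg.strictMono_pow.injective (by simpa using h3)
  rw [hr, smul_smul, h4, one_smul]

theorem exists_isSameOrderLift {g : alternatingGroup (Fin n)} (hg : Odd (orderOf g))
    (i : Fin n) : ∃ x : spinCover n, IsSameOrderLift g x := by
  have hg' : Odd (orderOf (g : Equiv.Perm (Fin n))) := by rwa [Subgroup.orderOf_coe]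
  obtain ⟨L, hL⟩ := exists_isEdgeSystem hg'
  have hodd := odd_of_mem_cycleType hg'
  set s := liftScale (g : Equiv.Perm (Fin n)).cycleType with hs
  have hs0 : s ≠ 0 := liftScale_ne_zero hodd
  have hsq : s⁻¹ ^ 2 * 2 ^ L.length = 1 := by
    rw [hL.length_eq, ← liftScale_sq hodd, ← mul_pow, inv_mul_cancel₀ hs0, one_pow]
  have hint : Intertwines (s⁻¹ • edgeProd L) (g : Equiv.Perm (Fin n)) := fun j => by
    rw [smul_mul_assoc, hL.intertwines j, mul_smul_comm]
  let x : spinCover n :=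
    ⟨(⟨s⁻¹ • edgeProd L, smul_edgeProd_mem_spinGroup hL.ne hsq i⟩, g),
      (mem_spinCover_iff _).2 hint⟩
  have hx : spinProj n x = g := rfl
  refine ⟨x, hx, Nat.dvd_antisymm (orderOf_dvd_of_pow_eq_one ?_) ?_⟩
  · refine Subtype.ext (Prod.ext (Subtype.ext ?_) (pow_orderOf_eq_one g))
    change spinVal (x ^ orderOf g) = 1
    have h2 : (g : Equiv.Perm (Fin n)) ^ orderOf g = 1 := by
      rw [← Subgroup.coe_pow, pow_orderOf_eq_one, Subgroup.coe_one]
    rw [spinVal_pow]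
    change (s⁻¹ • edgeProd L) ^ orderOf g = 1
    rw [smul_pow, hL.pow_eq _ h2, Algebra.smul_def, ← map_mul, ← mul_pow, inv_mul_cancel₀ hs0,
      one_pow, map_one]
  · exact orderOf_map_dvd (spinProj n) x

/-! ### The lift invariant in genus zero -/

theorem neg_one_pow_val {A : Type*} [Ring A] (o : ℕ) : (-1 : A) ^ (o : ZMod 2).val = (-1) ^ o := by
  rw [ZMod.val_natCast, ← neg_one_pow_eq_pow_mod_two]

theorem exists_edges_of_forall₂ {g : List (alternatingGroup (Fin n))} {x : List (spinCover n)}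
    (hg : ∀ a ∈ g, Odd (orderOf a)) (hx : List.Forall₂ IsSameOrderLift g x) :
    ∃ (K : List (Fin n × Fin n)) (o h : ℕ), K.length = (g.map index).sum ∧ 2 * h = K.length ∧
      (o : ZMod 2) = (g.map omega).sum ∧ (∀ p ∈ K, p.1 ≠ p.2) ∧
      edgeProd K = ((-1) ^ o * 2 ^ h : ℝ) • spinVal x.prod ∧
      Intertwines (edgeProd K) (g.prod : alternatingGroup (Fin n)) ∧
      ∀ a ∈ g, ∀ y, Relation.EqvGen (fun u v => (u, v) ∈ K) y ((a : Equiv.Perm (Fin n)) y) := by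
  induction hx with
  | nil =>
    exact ⟨[], 0, 0, rfl, rfl, by simp, by simp, by simp [edgeProd_nil, spinVal_one],
      by simpa [edgeProd_nil] using Intertwines.one, by simp⟩
  | @cons a y g x hay _ ih =>
    obtain ⟨K, o, h, h1, h2, h3, h4, h5, h6, h7⟩ := ih fun b hb => hg b (List.mem_cons_of_mem _ hb)
    have ha := hg a List.mem_cons_self
    have ha' : Odd (orderOf (a : Equiv.Perm (Fin n))) := by rwa [Subgroup.orderOf_coe]
    obtain ⟨L, hL⟩ := exists_isEdgeSystem ha'
    have hodd := odd_of_mem_cycleType ha'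
    have hv := hay.smul_spinVal ha hL
    rw [liftScale_eq hodd] at hv
    refine ⟨L ++ K, ((a : Equiv.Perm (Fin n)).cycleType.map fun k => (k ^ 2 - 1) / 8).sum + o,
      ((a : Equiv.Perm (Fin n)).cycleType.map fun k => (k - 1) / 2).sum + h,
      ?_, ?_, ?_, fun p hp => (List.mem_append.1 hp).elim (hL.ne p) (h4 p), ?_, ?_, ?_⟩
    · rw [List.length_append, h1, hL.length_eq, List.map_cons, List.sum_cons, index]
    · rw [mul_add, two_mul_sum_half hodd, h2, List.length_append, hL.length_eq]
    · rw [Nat.cast_add, h3, List.map_cons, List.sum_cons, omega]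
    · rw [edgeProd_append, hv, h5, smul_mul_smul_comm, List.prod_cons, spinVal_mul, pow_add,
        pow_add, mul_mul_mul_comm]
    · rw [edgeProd_append, List.prod_cons]
      exact hL.intertwines.mul h6
    · intro b hb z
      rcases List.mem_cons.1 hb with rfl | hb
      · exact (hL.eqvGen z).mono fun _ _ h => List.mem_append.2 (Or.inl h)
      · exact (h7 b hb z).mono fun _ _ h => List.mem_append.2 (Or.inr h)

theorem exists_alternatingGroup_apply_eq (hn : 3 ≤ n) (x y : Fin n) :
    ∃ a : alternatingGroup (Fin n), (a : Equiv.Perm (Fin n)) x = y := by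
  rcases eq_or_ne x y with rfl | h
  · exact ⟨1, rfl⟩
  · obtain ⟨z, hzx, hzy⟩ := Fin.exists_ne_and_ne_of_two_lt x y (by omega)
    refine ⟨⟨Equiv.swap x z * Equiv.swap x y, ?_⟩, ?_⟩
    · rw [Equiv.Perm.mem_alternatingGroup, map_mul, Equiv.Perm.sign_swap hzx.symm,
        Equiv.Perm.sign_swap h, neg_mul_neg, one_mul]
    · change Equiv.swap x z (Equiv.swap x y x) = y
      rw [Equiv.swap_apply_left, Equiv.swap_apply_of_ne_of_ne h.symm hzy.symm]

theorem eqvGen_of_closure_eq_top (hn : 3 ≤ n) {g : List (alternatingGroup (Fin n))}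
    (hg : Subgroup.closure {a | a ∈ g} = ⊤) {r : Fin n → Fin n → Prop}
    (hr : ∀ a ∈ g, ∀ y, Relation.EqvGen r y ((a : Equiv.Perm (Fin n)) y)) (x y : Fin n) :
    Relation.EqvGen r x y := by
  obtain ⟨a, rfl⟩ := exists_alternatingGroup_apply_eq hn x y
  have ha : a ∈ Subgroup.closure {a | a ∈ g} := hg ▸ Subgroup.mem_top a
  induction ha using Subgroup.closure_induction generalizing x with
  | mem a ha => exact hr a ha x
  | one => exact .refl _
  | mul a b _ _ iha ihb => exact .trans _ _ _ (ihb x) (iha _)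
  | inv a _ ih =>
    refine .symm _ _ ?_
    have h := ih (((a⁻¹ : alternatingGroup (Fin n)) : Equiv.Perm (Fin n)) x)
    rwa [← Equiv.Perm.mul_apply, ← Subgroup.coe_mul, mul_inv_cancel] at h

/-- In genus zero the product of the lifts of the same order is determined by the cycle types. -/
theorem spinVal_prod_eq (hn : 3 ≤ n) {g : List (alternatingGroup (Fin n))}
    {x : List (spinCover n)} (hodd : ∀ a ∈ g, Odd (orderOf a)) (hprod : g.prod = 1)
    (hgen : Subgroup.closure {a | a ∈ g} = ⊤) (hind : (g.map index).sum + 2 = 2 * n)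
    (hx : List.Forall₂ IsSameOrderLift g x) :
    spinVal x.prod = (-1) ^ (g.map omega).sum.val := by
  obtain ⟨K, o, h, h1, h2, h3, h4, h5, h6, h7⟩ := exists_edges_of_forall₂ hodd hx
  rw [hprod] at h6
  obtain ⟨r, hr⟩ := h6.eq_algebraMap (edgeProd_mem_even K)
  have hlt := neg_lt_of_edgeProd_eq ⟨0, by omega⟩ (eqvGen_of_closure_eq_top hn hgen h7) hr
    (k := h) (by omega)
  have hsq : r ^ 2 = (2 ^ h) ^ 2 := by
    apply algebraMap_Cl_injective (n := n)
    rw [← pow_mul, mul_comm h, h2, ← edgeProd_mul_star h4, hr, CliffordAlgebra.star_algebraMap,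
      ← map_mul, pow_two]
  have hr2 : r = 2 ^ h := by
    rcases sq_eq_sq_iff_eq_or_eq_neg.1 hsq with h | h
    · exact h
    · exact absurd h hlt.ne'
  rw [hr, hr2] at h5
  rw [← h3, neg_one_pow_val]
  have h8 := congrArg (fun z => ((-1) ^ o * (2 ^ h)⁻¹ : ℝ) • z) h5
  simp only [smul_smul] at h8
  rw [show ((-1) ^ o * (2 ^ h)⁻¹ * ((-1) ^ o * 2 ^ h) : ℝ) = 1 by
    rw [mul_mul_mul_comm, ← mul_pow, inv_mul_cancel₀ (by positivity)]; simp, one_smul,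
    Algebra.smul_def, ← map_mul, mul_assoc, inv_mul_cancel₀ (by positivity), mul_one] at h8
  rw [← h8, map_pow, map_neg, map_one]

theorem neg_one_pow_val_injective {s t : ZMod 2}
    (h : (-1 : Cl n) ^ s.val = (-1) ^ t.val) : s = t := by
  have h' : (-1 : ℝ) ^ s.val = (-1) ^ t.val := by
    apply algebraMap_Cl_injective (n := n)
    simpa using h
  have hz : ∀ z : ZMod 2, z = 0 ∨ z = 1 := by decide
  obtain rfl | rfl := hz s
  all_goals
    obtain rfl | rfl := hz t
    all_goals first | rfl | (exfalso; norm_num [ZMod.val_one] at h')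

theorem isLiftInvariant_iff (hn : 3 ≤ n) {g : List (alternatingGroup (Fin n))}
    (hodd : ∀ a ∈ g, Odd (orderOf a)) (hprod : g.prod = 1)
    (hgen : Subgroup.closure {a | a ∈ g} = ⊤) (hind : (g.map index).sum + 2 = 2 * n)
    (s : ZMod 2) : IsLiftInvariant g s ↔ s = (g.map omega).sum := by
  constructor
  · rintro ⟨x, hx, hs⟩
    rw [spinVal_prod_eq hn hodd hprod hgen hind hx] at hs
    exact (neg_one_pow_val_injective hs).symm
  · rintro rfl
    have hex : ∀ l : List (alternatingGroup (Fin n)), (∀ a ∈ l, Odd (orderOf a)) →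
        ∃ x : List (spinCover n), List.Forall₂ IsSameOrderLift l x := fun l hl => by
      induction l with
      | nil => exact ⟨[], .nil⟩
      | cons a l ih =>
        obtain ⟨x, hx⟩ := ih fun b hb => hl b (List.mem_cons_of_mem _ hb)
        obtain ⟨y, hy⟩ := exists_isSameOrderLift (hl a List.mem_cons_self) ⟨0, by omega⟩
        exact ⟨y :: x, .cons hy hx⟩
    obtain ⟨x, hx⟩ := hex g hodd
    exact ⟨x, hx, spinVal_prod_eq hn hodd hprod hgen hind hx⟩

/-! ### Absolute Nielsen classes -/

variable {C : Multiset (ConjClasses (alternatingGroup (Fin n)))}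

theorem Nielsen.mk_mem (g : Nielsen n C) {a : alternatingGroup (Fin n)} (ha : a ∈ g.1) :
    ConjClasses.mk a ∈ C := by
  rw [← g.2.1]
  exact Multiset.mem_coe.2 (List.mem_map_of_mem ha)

theorem Nielsen.card_eq (g : Nielsen n C) : Multiset.card C = g.1.length := by
  obtain ⟨g, rfl, -⟩ := g
  simp

theorem liftInvariants_eq (hn : 3 ≤ n) (hC : IsOddCycle C) (c : NielsenAbs n C)
    (hc : c.HasGenus 0) : c.liftInvariants = {c.omegaSum} := by
  have key : ∀ g : Nielsen n C, Quotient.mk (absSetoid n C) g = c → ∀ s,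
      IsLiftInvariant g.1 s ↔ s = c.omegaSum := by
    rintro g rfl s
    refine isLiftInvariant_iff hn (fun a ha => hC a (g.mk_mem ha)) g.2.2.1 g.2.2.2 ?_ s
    have h : 2 * ((n : ℤ) + (0 : ℕ) - 1) = ((g.1.map index).sum : ℕ) := hc
    omega
  obtain ⟨g, hg⟩ := Quotient.exists_rep c
  ext s
  exact ⟨fun ⟨g', hg', hs⟩ => (key g' hg' s).1 hs, fun hs => ⟨g, hg, (key g hg s).2 hs⟩⟩

theorem sum_map_eq_of_class_function {M : Type*} [AddCommMonoid M]
    {F : alternatingGroup (Fin n) → M} (hF : ∀ a b, IsConj a b → F a = F b) (g : Nielsen n C) :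
    (g.1.map F).sum = (C.map fun c => F c.exists_rep.choose).sum := by
  obtain ⟨g, rfl, -⟩ := g
  rw [Multiset.map_coe, Multiset.sum_coe, List.map_map]
  refine congrArg List.sum (List.map_congr_left fun a _ => hF _ _ ?_)
  exact (ConjClasses.mk_eq_mk_iff_isConj.1 (ConjClasses.mk a).exists_rep.choose_spec).symm

theorem cycleType_eq_of_isConj {a b : alternatingGroup (Fin n)} (h : IsConj a b) :
    (a : Equiv.Perm (Fin n)).cycleType = (b : Equiv.Perm (Fin n)).cycleType := by
  obtain ⟨c, rfl⟩ := isConj_iff.1 h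
  simp [Equiv.Perm.cycleType_conj]

theorem indexSum_eq_indexSum (c c' : NielsenAbs n C) : c.indexSum = c'.indexSum := by
  obtain ⟨g, rfl⟩ := Quotient.exists_rep c
  obtain ⟨g', rfl⟩ := Quotient.exists_rep c'
  have hF : ∀ a b : alternatingGroup (Fin n), IsConj a b → index a = index b := fun a b h => by
    rw [index, index, cycleType_eq_of_isConj h]
  exact (sum_map_eq_of_class_function hF g).trans (sum_map_eq_of_class_function hF g').symm

theorem omegaSum_eq_omegaSum (c c' : NielsenAbs n C) : c.omegaSum = c'.omegaSum := by
  obtain ⟨g, rfl⟩ := Quotient.exists_rep c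
  obtain ⟨g', rfl⟩ := Quotient.exists_rep c'
  have hF : ∀ a b : alternatingGroup (Fin n), IsConj a b → omega a = omega b := fun a b h => by
    rw [omega, omega, cycleType_eq_of_isConj h]
  exact (sum_map_eq_of_class_function hF g).trans (sum_map_eq_of_class_function hF g').symm

theorem IsThreeCycles.isOddCycle (hC : IsThreeCycles C) : IsOddCycle C := fun g hg => by
  rw [← Subgroup.orderOf_coe, (hC g hg).orderOf]
  decide

theorem IsThreeCycles.indexSum_eq (hC : IsThreeCycles C) (c : NielsenAbs n C) :
    c.indexSum = 2 * Multiset.card C := by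
  obtain ⟨g, rfl⟩ := Quotient.exists_rep c
  change (g.1.map index).sum = _
  rw [List.map_congr_left (g := fun _ => 2) fun a ha => ?_]
  · rw [g.card_eq]
    simp [mul_comm]
  · rw [index, show (a : Equiv.Perm (Fin n)).cycleType = {3} from hC a (g.mk_mem ha)]
    simp

theorem IsThreeCycles.omegaSum_eq (hC : IsThreeCycles C) (c : NielsenAbs n C) :
    c.omegaSum = (Multiset.card C : ℕ) := by
  obtain ⟨g, rfl⟩ := Quotient.exists_rep c
  change (g.1.map omega).sum = _
  rw [List.map_congr_left (g := fun _ => 1) fun a ha => ?_]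
  · rw [g.card_eq]
    simp
  · rw [omega, show (a : Equiv.Perm (Fin n)).cycleType = {3} from hC a (g.mk_mem ha)]
    simp

end SpinLift

theorem mainTheorem4 (n : ℕ) (hn : 3 ≤ n)
    (C : Multiset (ConjClasses (alternatingGroup (Fin n)))) :
    (SpinLift.IsOddCycle C →
      (∀ c : SpinLift.NielsenAbs n C, c.HasGenus 0 → c.liftInvariants = {c.omegaSum}) ∧
      (∀ c c' : SpinLift.NielsenAbs n C, c.HasGenus 0 → c.liftInvariants = c'.liftInvariants)) ∧
    (SpinLift.IsThreeCycles C → Multiset.card C = n - 1 →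
      ∀ c : SpinLift.NielsenAbs n C,
        c.HasGenus 0 ∧ c.liftInvariants = {((n - 1 : ℕ) : ZMod 2)}) := by
  refine ⟨fun hC => ⟨fun c hc => SpinLift.liftInvariants_eq hn hC c hc, fun c c' hc => ?_⟩,
    fun hC hcard c => ?_⟩
  · have hc' : c'.HasGenus 0 := by
      rw [SpinLift.NielsenAbs.HasGenus, SpinLift.indexSum_eq_indexSum c' c]
      exact hc
    rw [SpinLift.liftInvariants_eq hn hC c hc, SpinLift.liftInvariants_eq hn hC c' hc',
      SpinLift.omegaSum_eq_omegaSum c c']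
  · have hc : c.HasGenus 0 := by
      rw [SpinLift.NielsenAbs.HasGenus, hC.indexSum_eq c, hcard]
      push_cast [Nat.cast_sub (show 1 ≤ n by omega)]
      ring
    refine ⟨hc, ?_⟩
    rw [SpinLift.liftInvariants_eq hn hC.isOddCycle c hc, hC.omegaSum_eq c, hcard]
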